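/- All matroids are finite. For a matroid $M$, write $r_M$ for its rank function, $M^*$ for its dual and $r^*_M$ for the rank function of $M^*$; $M$ is cosimple if $M^*$ is simple. For $n\ge 3$, a sequence $x_1,\dots,x_n,y_1,\dots,y_n$ of elements of a $3$-connected matroid $M$ is a carambole of $M$ if $y_1,\dots,y_n$ are distinct, $L=\{y_1,\dots,y_n\}$ is a line (a rank-$2$ flat) of $M$ such that the simplification $\mathrm{si}(M/L)$ is $3$-connected, and $(L\setminus\{y_i\})\cup\{x_i\}$ is a cocircuit of $M$ for each $i\in\{1,\dots,n\}$. For distinct elements $x_1,\dots,x_n,y_1,\dots,y_n$ with $X=\{x_1,\dots,x_n\}$ and $L=\{y_1,\dots,y_n\}$, let $\Theta_n$ be the matroid on $X\cup L$ whose circuits are: all $3$-element subsets of $X$; the sets $(L\setminus\{y_i\})\cup\{x_i\}$; and the sets $(L\setminus\{y_u\})\cup\{x_s,x_t\}$ with $s,t,u$ distinct. For matroids $M_1,M_2$ with $E(M_1)\cap E(M_2)=T$ and $M_1|T=M_2|T$ such that, for some $i\in\{1,2\}$, $\mathrm{cl}_{M_i}(T)$ is a modular flat of $M_i$ each of whose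 elements outside $T$ is a loop or is parallel to an element of $T$, the generalized parallel connection $P_T(M_1,M_2)$ is the matroid on $E(M_1)\cup E(M_2)$ whose flats are the sets $F$ such that $F\cap E(M_i)$ is a flat of $M_i$ for $i=1,2$. Let $n\ge 3$, $X=\{x_1,\dots,x_n\}$ and $L=\{y_1,\dots,y_n\}$. Suppose that $H$ is a cosimple matroid with $X\subseteq E(H)$, $r^*_H(X)=2$ and $L\cap E(H)=\emptyset$, and that $M$ is a $3$-connected simple matroid having $x_1,\dots,x_n,y_1,\dots,y_n$ as a carambole. Then the $2n$ elements $x_1,\dots,x_n,y_1,\dots,y_n$ are distinct, and $H=M/L$ if and only if $M^*=P_X(H^*,\Theta_n)$ (the right-hand side including that this generalized parallel connection is defined). -/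

import Mathlib

namespace Matroid

variable {α : Type*}

/-- A matroid is simple if it has neither loops nor parallel pairs,
i.e. all its circuits have at least three elements. -/
def IsSimple (M : Matroid α) : Prop :=
  ∀ C, M.IsCircuit C → 3 ≤ C.encard

/-- A matroid is cosimple if its dual is simple. -/
def IsCosimple (M : Matroid α) : Prop := M✶.IsSimple

/-- `A` and its complement form a (Tutte) `k`-separation of `M`: both sides have at least `k`
elements and `r(A) + r(E - A) - r(M) < k`. -/
def IsSeparation (M : Matroid α) (k : ℕ) (A : Set α) : Prop :=
  A ⊆ M.E ∧ (k : ℕ∞) ≤ A.encard ∧ (k : ℕ∞) ≤ (M.E \ A).encard ∧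
    M.eRk A + M.eRk (M.E \ A) < M.eRank + k

/-- `M` is 3-connected: it has no `1`-separation and no `2`-separation. -/
def IsThreeConnected (M : Matroid α) : Prop :=
  ∀ k : ℕ, 1 ≤ k → k < 3 → ∀ A, ¬ M.IsSeparation k A

/-- `N` is a simplification `si(M)` of `M`: it is obtained from `M` by deleting all loops and
all but one element of every parallel class. (Any two simplifications are isomorphic.) -/
def IsSimplification (N M : Matroid α) : Prop :=
  ∃ S : Set α, (∀ e ∈ S, M.IsNonloop e) ∧
    (∀ e, M.IsNonloop e → ∃! f, f ∈ S ∧ M.closure {e} = M.closure {f}) ∧ N = M ↾ S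

/-- `Y` is vertically contractible in `M`: `si(M / Y)` is 3-connected. -/
def IsVerticallyContractible (M : Matroid α) (Y : Set α) : Prop :=
  Y ⊆ M.E ∧ ∃ N : Matroid α, N.IsSimplification (M ／ Y) ∧ N.IsThreeConnected

/-- A line is a flat of rank two. -/
def IsLine (M : Matroid α) (L : Set α) : Prop := M.IsFlat L ∧ M.eRk L = 2

/-- The sequence `x₁, …, xₙ, y₁, …, yₙ` is a carambole of `M`. -/
structure IsCarambole (M : Matroid α) {n : ℕ} (x y : Fin n → α) : Prop where
  three_le : 3 ≤ n
  injective : Function.Injective y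
  isLine : M.IsLine (Set.range y)
  contractible : M.IsVerticallyContractible (Set.range y)
  isCocircuit : ∀ i, M.IsCocircuit (insert (x i) (Set.range y \ {y i}))

/-- `F` is a modular flat of `M`. -/
def IsModularFlat (M : Matroid α) (F : Set α) : Prop :=
  M.IsFlat F ∧ ∀ G, M.IsFlat G → M.eRk F + M.eRk G = M.eRk (F ∪ G) + M.eRk (F ∩ G)

/-- The condition on one of the parts under which generalized parallel connections across `T` are
defined: the closure of `T` is a modular flat, and every element of it outside `T` is a loop or
parallel to an element of `T`. -/
def IsModularlyEmbedded (M : Matroid α) (T : Set α) : Prop :=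
  M.IsModularFlat (M.closure T) ∧
    ∀ e ∈ M.closure T \ T, M.IsLoop e ∨ ∃ f ∈ T, M.IsNonloop f ∧ M.closure {e} = M.closure {f}

/-- `P = P_T(M₁, M₂)`: the generalized parallel connection of `M₁` and `M₂` across `T` is defined,
and `P` is the matroid on `E(M₁) ∪ E(M₂)` whose flats are the sets that
meet `E(M₁)` in a flat of `M₁` and `E(M₂)` in a flat of `M₂`. -/
structure IsGenParallelConnection (P : Matroid α) (T : Set α) (M₁ M₂ : Matroid α) : Prop where
  inter_eq : M₁.E ∩ M₂.E = T
  restrict_eq : M₁ ↾ T = M₂ ↾ T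
  modular : M₁.IsModularlyEmbedded T ∨ M₂.IsModularlyEmbedded T
  ground_eq : P.E = M₁.E ∪ M₂.E
  isFlat_iff : ∀ F ⊆ P.E, P.IsFlat F ↔ M₁.IsFlat (F ∩ M₁.E) ∧ M₂.IsFlat (F ∩ M₂.E)

/-- There is at most one generalized parallel connection. -/
theorem IsGenParallelConnection.unique {P Q M₁ M₂ : Matroid α} {T : Set α}
    (hP : P.IsGenParallelConnection T M₁ M₂) (hQ : Q.IsGenParallelConnection T M₁ M₂) : P = Q := by
  have hE : P.E = Q.E := hP.ground_eq.trans hQ.ground_eq.symm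
  have hF : ∀ F, P.IsFlat F ↔ Q.IsFlat F := by
    intro F
    by_cases h : F ⊆ P.E
    · rw [hP.isFlat_iff F h, hQ.isFlat_iff F (hE ▸ h)]
    · exact ⟨fun h' => absurd h'.subset_ground h,
        fun h' => absurd (hE ▸ h'.subset_ground) h⟩
  refine ext_closure fun X => ?_
  simp only [closure, hE, hF]

/-- The circuits of `Θₙ`; the index `Sum.inl i` stands for `xᵢ` and `Sum.inr i` for `yᵢ`. -/
def thetaCircuits (n : ℕ) : Set (Set (Fin n ⊕ Fin n)) :=
  {C | (∃ i j k, i ≠ j ∧ i ≠ k ∧ j ≠ k ∧ C = {Sum.inl i, Sum.inl j, Sum.inl k}) ∨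
    (∃ i, C = insert (Sum.inl i) (Sum.inr '' {i}ᶜ)) ∨
    (∃ s t u, s ≠ t ∧ s ≠ u ∧ t ≠ u ∧ C = {Sum.inl s, Sum.inl t} ∪ Sum.inr '' {u}ᶜ)}

def ThetaP {n : ℕ} (A B : Finset (Fin n)) : Prop :=
  A.card ≤ 2 ∧ A.card + B.card ≤ n ∧ ∀ i, ¬ (A = {i} ∧ B = {i}ᶜ)

theorem theta_card_compl {n : ℕ} (i : Fin n) : ({i}ᶜ : Finset (Fin n)).card + 1 = n := by
  have := Finset.card_add_card_compl ({i} : Finset (Fin n))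
  simp only [Finset.card_singleton, Fintype.card_fin] at this
  omega

theorem theta_eq_compl {n : ℕ} {i : Fin n} {B : Finset (Fin n)} (hi : i ∉ B)
    (hB : n ≤ B.card + 1) : B = {i}ᶜ := by
  refine Finset.eq_of_subset_of_card_le ?_ ?_
  · intro b hb
    simp only [Finset.mem_compl, Finset.mem_singleton]
    rintro rfl
    exact hi hb
  · have := theta_card_compl i
    omega

open Classical in
theorem thetaP_iff {n : ℕ} (I : Set (Fin n ⊕ Fin n)) :
    (∀ C ∈ thetaCircuits n, ¬ C ⊆ I) ↔
      ThetaP (Finset.univ.filter fun i => Sum.inl i ∈ I)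
        (Finset.univ.filter fun i => Sum.inr i ∈ I) := by
  set A := Finset.univ.filter fun i => Sum.inl i ∈ I with hA
  set B := Finset.univ.filter fun i => Sum.inr i ∈ I with hB
  have mA : ∀ i, Sum.inl i ∈ I ↔ i ∈ A := by simp [hA]
  have mB : ∀ i, Sum.inr i ∈ I ↔ i ∈ B := by simp [hB]
  have sB : ∀ u, Sum.inr '' ({u}ᶜ : Set (Fin n)) ⊆ I ↔ ({u}ᶜ : Finset (Fin n)) ⊆ B := by
    intro u
    simp [Set.subset_def, Finset.subset_iff, ← mB]
  constructor
  · intro h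
    have h1 : ∀ i j k, i ≠ j → i ≠ k → j ≠ k → i ∈ A → j ∈ A → k ∉ A := by
      intro i j k hij hik hjk hi hj hk
      refine h _ (Or.inl ⟨i, j, k, hij, hik, hjk, rfl⟩) ?_
      simp [Set.insert_subset_iff, mA, hi, hj, hk]
    have h2 : ∀ i, i ∈ A → ¬ ({i}ᶜ : Finset (Fin n)) ⊆ B := by
      intro i hi hB
      refine h _ (Or.inr (Or.inl ⟨i, rfl⟩)) ?_
      rw [Set.insert_subset_iff, mA, sB]
      exact ⟨hi, hB⟩
    have h3 : ∀ s t u, s ≠ t → s ≠ u → t ≠ u → s ∈ A → t ∈ A →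
        ¬ ({u}ᶜ : Finset (Fin n)) ⊆ B := by
      intro s t u hst hsu htu hs ht hB
      refine h _ (Or.inr (Or.inr ⟨s, t, u, hst, hsu, htu, rfl⟩)) ?_
      rw [Set.union_subset_iff, sB]
      simp [Set.insert_subset_iff, mA, hs, ht, hB]
    have hA2 : A.card ≤ 2 := by
      by_contra hc
      obtain ⟨i, j, k, hi, hj, hk, hij, hik, hjk⟩ := Finset.two_lt_card_iff.1 (not_le.1 hc)
      exact h1 i j k hij hik hjk hi hj hk
    refine ⟨hA2, ?_, ?_⟩
    · by_contra hc
      have hBn : B.card ≤ n := by simpa using Finset.card_le_univ B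
      by_cases hu : ∃ u, u ∉ B
      · obtain ⟨u, hu⟩ := hu
        have hBu := theta_eq_compl hu (by omega)
        have := theta_card_compl u
        rw [← hBu] at this
        obtain ⟨s, t, hst, hAst⟩ := Finset.card_eq_two.1 (show A.card = 2 by omega)
        by_cases hsu : s = u
        · exact h2 s (by simp [hAst]) (by rw [hsu, hBu])
        by_cases htu : t = u
        · exact h2 t (by simp [hAst]) (by rw [htu, hBu])
        exact h3 s t u hst hsu htu (by simp [hAst]) (by simp [hAst]) hBu.ge
      · push Not at hu
        have : 0 < A.card := by omega
        obtain ⟨i, hi⟩ := Finset.card_pos.1 this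
        exact h2 i hi fun b _ => hu b
    · rintro i ⟨hi, hB⟩
      exact h2 i (by simp [hi]) hB.ge
  · rintro ⟨h1, h2, h3⟩ C (⟨i, j, k, hij, hik, hjk, rfl⟩ | ⟨i, rfl⟩ |
      ⟨s, t, u, hst, hsu, htu, rfl⟩) hC
    · simp only [Set.insert_subset_iff, Set.singleton_subset_iff, mA] at hC
      have := Finset.two_lt_card_iff.2 ⟨i, j, k, hC.1, hC.2.1, hC.2.2, hij, hik, hjk⟩
      omega
    · rw [Set.insert_subset_iff, mA, sB] at hC
      have c := theta_card_compl i
      have c1 := Finset.card_le_card hC.2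
      have c2 := Finset.card_le_card (Finset.singleton_subset_iff.2 hC.1)
      rw [Finset.card_singleton] at c2
      refine h3 i ⟨(Finset.eq_of_subset_of_card_le (Finset.singleton_subset_iff.2 hC.1) ?_).symm,
        (Finset.eq_of_subset_of_card_le hC.2 ?_).symm⟩
      · rw [Finset.card_singleton]; omega
      · omega
    · rw [Set.union_subset_iff, sB] at hC
      simp only [Set.insert_subset_iff, Set.singleton_subset_iff, mA] at hC
      have c := theta_card_compl u
      have c1 := Finset.card_le_card hC.2
      have := Finset.one_lt_card_iff.2 ⟨s, t, hC.1.1, hC.1.2, hst⟩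
      omega

theorem ThetaP.aug {n : ℕ} {A B A' B' : Finset (Fin n)} (h : ThetaP A B)
    (h' : ThetaP A' B') (hlt : A.card + B.card < A'.card + B'.card) :
    (∃ a ∈ A', a ∉ A ∧ ThetaP (insert a A) B) ∨ (∃ b ∈ B', b ∉ B ∧ ThetaP A (insert b B)) := by
  obtain ⟨h1, h2, h3⟩ := h
  obtain ⟨h1', h2', h3'⟩ := h'
  have bad : ∀ {A B : Finset (Fin n)} {i}, A = {i} ∧ B = {i}ᶜ → A.card = 1 ∧ B.card + 1 = n := by
    rintro A B i ⟨rfl, rfl⟩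
    exact ⟨by simp, theta_card_compl i⟩
  have exB : B.card < B'.card → ∃ b ∈ B', b ∉ B := Finset.exists_mem_notMem_of_card_lt_card
  by_cases hA2 : A.card = 2
  · obtain ⟨b, hb, hbB⟩ := exB (by omega)
    refine Or.inr ⟨b, hb, hbB, h1, ?_, fun i hi => ?_⟩
    · rw [Finset.card_insert_of_notMem hbB]; omega
    · have := bad hi; omega
  by_cases hn : A.card + B.card + 2 ≤ n
  · by_cases ha : ∃ a ∈ A', a ∉ A
    · obtain ⟨a, ha, haA⟩ := ha
      have hc := Finset.card_insert_of_notMem haA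
      refine Or.inl ⟨a, ha, haA, by omega, by omega, fun i hi => ?_⟩
      have := bad hi; omega
    · push Not at ha
      have := Finset.card_le_card (show A' ⊆ A from ha)
      obtain ⟨b, hb, hbB⟩ := exB (by omega)
      have hc := Finset.card_insert_of_notMem hbB
      refine Or.inr ⟨b, hb, hbB, by omega, by omega, fun i hi => ?_⟩
      have := bad hi; omega
  by_cases hA1 : A.card = 1
  · by_cases ha : ∃ a ∈ A', a ∉ A
    · obtain ⟨a, ha, haA⟩ := ha
      have hc := Finset.card_insert_of_notMem haA
      refine Or.inl ⟨a, ha, haA, by omega, by omega, fun i hi => ?_⟩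
      have := bad hi; omega
    push Not at ha
    have hsub : A' ⊆ A := ha
    have hcA := Finset.card_le_card hsub
    obtain ⟨i, rfl⟩ := Finset.card_eq_one.1 hA1
    obtain ⟨b, hb, hbB⟩ := exB (by omega)
    have key : ∀ b ∉ B, insert b B ≠ {i}ᶜ → ThetaP {i} (insert b B) := by
      intro b hb hne
      have hc := Finset.card_insert_of_notMem hb
      refine ⟨by omega, by omega, ?_⟩
      rintro j ⟨hj, hj'⟩
      rw [Finset.singleton_inj] at hj
      subst hj
      exact hne hj'
    by_cases hne : insert b B = {i}ᶜ
    · have hiB : i ∉ B := fun hi => by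
        have : i ∈ insert b B := Finset.mem_insert_of_mem hi
        rw [hne] at this
        simp at this
      by_cases hiB' : i ∈ B'
      · refine Or.inr ⟨i, hiB', hiB, key i hiB fun h => ?_⟩
        have : i ∈ insert i B := Finset.mem_insert_self _ _
        rw [h] at this
        simp at this
      · exfalso
        have e := theta_eq_compl hiB' (by omega)
        have c := theta_card_compl i
        rw [← e] at c
        exact h3' i ⟨Finset.eq_of_subset_of_card_le hsub (by omega), e⟩
    · exact Or.inr ⟨b, hb, hbB, key b hbB hne⟩
  have hA0 : A.card = 0 := by omega
  obtain rfl := Finset.card_eq_zero.1 hA0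
  by_cases hb : ∃ b ∈ B', b ∉ B
  · obtain ⟨b, hb, hbB⟩ := hb
    have hc := Finset.card_insert_of_notMem hbB
    refine Or.inr ⟨b, hb, hbB, by omega, by omega, fun i hi => ?_⟩
    have := bad hi; omega
  push Not at hb
  have hsub : B' ⊆ B := hb
  have hcB := Finset.card_le_card hsub
  have key : ∀ a, B ≠ {a}ᶜ → ThetaP (insert a ∅) B := by
    intro a hne
    refine ⟨by simp, by simp only [Finset.card_insert_of_notMem (Finset.notMem_empty a)]; omega, ?_⟩
    rintro j ⟨hj, hj'⟩
    have : a = j := by simpa using hj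
    subst this
    exact hne hj'
  obtain ⟨a, ha⟩ := Finset.card_pos.1 (show 0 < A'.card by omega)
  by_cases hBa : B = {a}ᶜ
  · by_cases hex : ∃ c ∈ A', c ≠ a
    · obtain ⟨c, hc, hca⟩ := hex
      refine Or.inl ⟨c, hc, by simp, key c fun h => hca ?_⟩
      have := hBa.symm.trans h
      simpa using this.symm
    · exfalso
      push Not at hex
      have hA' : A' = {a} := Finset.eq_singleton_iff_unique_mem.2 ⟨ha, hex⟩
      subst hA'
      simp only [Finset.card_singleton, Finset.card_empty] at *
      exact h3' a ⟨rfl, (Finset.eq_of_subset_of_card_le hsub (by omega)).trans hBa⟩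
  · exact Or.inl ⟨a, ha, by simp, key a hBa⟩

open Classical in
theorem theta_ncard_eq {n : ℕ} (I : Set (Fin n ⊕ Fin n)) :
    I.ncard = (Finset.univ.filter fun i => Sum.inl i ∈ I).card +
      (Finset.univ.filter fun i => Sum.inr i ∈ I).card := by
  have h : I = ((Finset.univ.filter fun i => Sum.inl i ∈ I).disjSum
      (Finset.univ.filter fun i => Sum.inr i ∈ I) : Finset (Fin n ⊕ Fin n)) := by
    ext (i | i) <;> simp
  conv_lhs => rw [h]
  rw [Set.ncard_coe_finset, Finset.card_disjSum]

/-- The matroid `Θₙ` on the `2n` labels of `x₁, …, xₙ, y₁, …, yₙ`: a set is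
independent if and only if it contains none of the sets in `thetaCircuits n`. -/
def theta (n : ℕ) : Matroid (Fin n ⊕ Fin n) :=
  (IndepMatroid.ofFinite (E := Set.univ) Set.finite_univ
    (Indep := fun I => ∀ C ∈ thetaCircuits n, ¬ C ⊆ I)
    (indep_empty := by
      rw [thetaP_iff]
      refine ⟨by simp, by simp, ?_⟩
      rintro i ⟨h, -⟩
      have : i ∈ ({i} : Finset (Fin n)) := Finset.mem_singleton_self i
      rw [← h] at this
      simp at this)
    (indep_subset := fun _ _ hJ hIJ C hC hCI => hJ C hC (hCI.trans hIJ))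
    (indep_aug := by
      classical
      intro I J hI hJ hlt
      rw [theta_ncard_eq, theta_ncard_eq] at hlt
      rw [thetaP_iff] at hI hJ
      rcases hI.aug hJ hlt with ⟨a, ha, haI, h⟩ | ⟨a, ha, haI, h⟩
      · refine ⟨Sum.inl a, by simpa using ha, by simpa using haI, ?_⟩
        rw [thetaP_iff]
        convert h using 1
        · ext i; simp
        · ext i; simp
      · refine ⟨Sum.inr a, by simpa using ha, by simpa using haI, ?_⟩
        rw [thetaP_iff]
        convert h using 1
        · ext i; simp
        · ext i; simp)
    (subset_ground := fun _ _ => Set.subset_univ _)).matroid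

theorem theta_indep_iff {n : ℕ} {I : Set (Fin n ⊕ Fin n)} :
    (theta n).Indep I ↔ ∀ C ∈ thetaCircuits n, ¬ C ⊆ I := Iff.rfl

theorem thetaCircuits_antichain {n : ℕ} {C D : Set (Fin n ⊕ Fin n)} (hC : C ∈ thetaCircuits n)
    (hD : D ∈ thetaCircuits n) (h : C ⊆ D) : C = D := by
  have hl : ∀ i, Sum.inl i ∈ C → Sum.inl i ∈ D := fun i hi => h hi
  have hr : ∀ i, Sum.inr i ∈ C → Sum.inr i ∈ D := fun i hi => h hi
  clear h
  rcases hC with ⟨i, j, k, hij, hik, hjk, rfl⟩ | ⟨i, rfl⟩ | ⟨s, t, u, hst, hsu, htu, rfl⟩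
  · have h1 := hl i (by simp)
    have h2 := hl j (by simp)
    have h3 := hl k (by simp)
    rcases hD with ⟨i', j', k', hij', hik', hjk', rfl⟩ | ⟨i', rfl⟩ |
      ⟨s', t', u', hst', hsu', htu', rfl⟩ <;> simp at h1 h2 h3
    · clear hl hr
      ext (a | a) <;> simp
      grind
    · grind
    · grind
  · have h1 := hl i (by simp)
    have h2 : ∀ a, a ≠ i → Sum.inr a ∈ D := fun a ha => hr a (by simpa using ha)
    rcases hD with ⟨i', j', k', hij', hik', hjk', rfl⟩ | ⟨i', rfl⟩ |
      ⟨s', t', u', hst', hsu', htu', rfl⟩ <;> simp at h1 h2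
    · have := h2 i'
      have := h2 j'
      grind
    · rw [h1]
    · grind
  · have h1 := hl s (by simp)
    have h3 := hl t (by simp)
    have h2 : ∀ a, a ≠ u → Sum.inr a ∈ D := fun a ha => hr a (by simpa using ha)
    rcases hD with ⟨i', j', k', hij', hik', hjk', rfl⟩ | ⟨i', rfl⟩ |
      ⟨s', t', u', hst', hsu', htu', rfl⟩ <;> simp at h1 h2 h3
    · exact absurd (h2 s) (by simpa using hsu)
    · grind
    · have hu : u = u' := by
        by_contra hne
        exact h2 u' (Ne.symm hne) rfl
      subst hu
      clear hl hr
      ext (a | a) <;> simp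
      grind

/-- The circuits of `theta n` are the members of `thetaCircuits n`. -/
theorem theta_isCircuit_iff {n : ℕ} {C : Set (Fin n ⊕ Fin n)} :
    (theta n).IsCircuit C ↔ C ∈ thetaCircuits n := by
  have hdep : ∀ D, (theta n).Dep D ↔ ∃ C ∈ thetaCircuits n, C ⊆ D := by
    intro D
    rw [Dep, theta_indep_iff]
    push Not
    exact ⟨fun h => h.1, fun h => ⟨h, Set.subset_univ D⟩⟩
  constructor
  · intro h
    obtain ⟨D, hD, hDC⟩ := (hdep C).1 h.prop
    rwa [← h.eq_of_subset ((hdep D).2 ⟨D, hD, subset_rfl⟩) hDC]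
  · intro h
    refine ⟨(hdep C).2 ⟨C, h, subset_rfl⟩, fun D hD hDC => ?_⟩
    obtain ⟨D', hD', hD'D⟩ := (hdep D).1 hD
    rwa [← thetaCircuits_antichain hD' h (hD'D.trans hDC)]

/-- The copy of `Θₙ` on `{x₁, …, xₙ} ∪ {y₁, …, yₙ}`, where these `2n` elements are distinct. -/
def thetaOn {n : ℕ} (x y : Fin n → α) (h : Function.Injective (Sum.elim x y)) : Matroid α :=
  (theta n).map (Sum.elim x y) h.injOn

end Matroid

/-! ### Flats, restrictions and gluing. -/

namespace Matroid

open Set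

variable {α : Type*}

/-! Everything takes place in `M✶`. Write X and Y for the sets of the xᵢ and the yᵢ. The line Y has
rank two, so 3-connectivity makes it independent in `M✶` (`IsThreeConnected.coindep`). Each xᵢ then
has the fundamental circuit {xᵢ} ∪ (Y - yᵢ), and submodularity bounds r*(X) by 2. This is recorded
as `IsThetaFrame`. These data determine the restriction to X ∪ Y, which is Θₙ
(`restrict_eq_thetaOn`), and in it X is a modular flat (`isModularFlat_range_x`).

Because r*(E - Y) + r*(X ∪ Y) ≤ r*(E) + r*(X), the parts E - Y and X ∪ Y meet as freely as their
overlap X allows. Together with modularity this makes any two flats of the parts that agree on X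
form a flat of `M✶` (`isFlat_of_isModularFlat_restrict`). Hence `M✶` is the generalized parallel
connection of `M✶ ＼ Y` = (M / Y)* and Θₙ. Conversely, a generalized parallel connection restricts to
each of its parts, so `H✶` must be `M✶ ＼ Y`. -/

theorem restrict_isFlat_iff {N : Matroid α} {A F : Set α} (hA : A ⊆ N.E) (hF : F ⊆ A) :
    (N ↾ A).IsFlat F ↔ N.closure F ∩ A = F := by
  rw [isFlat_iff_closure_eq, restrict_closure_eq _ hF hA]

theorem IsFlat.inter_restrict {N : Matroid α} {A F : Set α} (hF : N.IsFlat F) (hA : A ⊆ N.E) :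
    (N ↾ A).IsFlat (F ∩ A) := by
  rw [restrict_isFlat_iff hA inter_subset_right]
  refine subset_antisymm (inter_subset_inter_left _ ?_) (subset_inter ?_ inter_subset_right)
  · exact (N.closure_subset_closure inter_subset_left).trans hF.closure.subset
  · exact N.subset_closure _ (inter_subset_right.trans hA)

theorem IsFlat.eq_of_subset_of_eRk_le {N : Matroid α} [N.RankFinite] {F G : Set α}
    (hF : N.IsFlat F) (hG : N.IsFlat G) (hFG : F ⊆ G) (h : N.eRk G ≤ N.eRk F) : F = G := by
  rw [← hF.closure, ← hG.closure]
  exact (N.isRkFinite_set F).closure_eq_closure_of_subset_of_eRk_ge_eRk hFG h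

theorem exists_nat_rank (N : Matroid α) [N.RankFinite] :
    ∃ r : Set α → ℕ, ∀ S, N.eRk S = r S :=
  ⟨fun S => (N.eRk S).toNat, fun S => (ENat.natCast_toNat (by simp)).symm⟩

/-- If `N` is glued from `N ↾ A` and `N ↾ B` across `A ∩ B` with the expected rank, and `A ∩ B` is
modular in `N ↾ B`, then two flats of the parts that agree on `A ∩ B` form a flat of `N`. -/
theorem isFlat_of_isModularFlat_restrict {N : Matroid α} [N.RankFinite] {A B F : Set α}
    (hAB : A ∪ B = N.E) (hr : N.eRk A + N.eRk B ≤ N.eRank + N.eRk (A ∩ B))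
    (hmod : (N ↾ B).IsModularFlat (A ∩ B)) (hF : F ⊆ N.E)
    (hFA : (N ↾ A).IsFlat (F ∩ A)) (hFB : (N ↾ B).IsFlat (F ∩ B)) : N.IsFlat F := by
  have hA : A ⊆ N.E := hAB ▸ subset_union_left
  have hB : B ⊆ N.E := hAB ▸ subset_union_right
  obtain ⟨r, hrk⟩ := N.exists_nat_rank
  have mono : ∀ {S T : Set α}, S ⊆ T → r S ≤ r T := fun {S T} h => by
    have := N.eRk_mono h
    rw [hrk, hrk] at this
    exact_mod_cast this
  have submod : ∀ S T, r (S ∩ T) + r (S ∪ T) ≤ r S + r T := fun S T => by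
    have := N.eRk_inter_add_eRk_union_le S T
    simp only [hrk] at this
    exact_mod_cast this
  set X := A ∩ B with hX
  have hr' : r A + r B ≤ r N.E + r X := by
    rw [← eRk_ground] at hr
    simp only [hrk] at hr
    exact_mod_cast hr
  have hmodB : ∀ K, (N ↾ B).IsFlat K → r X + r K = r (X ∪ K) + r (X ∩ K) := fun K hK => by
    have hKB : K ⊆ B := hK.subset_ground
    have hXB : X ⊆ B := inter_subset_right
    have := hmod.2 K hK
    rw [restrict_eRk_eq _ hXB, restrict_eRk_eq _ hKB, restrict_eRk_eq _ (union_subset hXB hKB),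
      restrict_eRk_eq _ (inter_subset_left.trans hXB)] at this
    simp only [hrk] at this
    exact_mod_cast this
  -- The tightness `hr` passes from A and B to smaller sets containing X, by submodularity for the
  -- pairs A, S ∪ T and B, A ∪ T.
  have split : ∀ S T, X ⊆ S → S ⊆ A → X ⊆ T → T ⊆ B → r S + r T ≤ r (S ∪ T) + r X := by
    intro S T hXS hSA hXT hTB
    have h1 := submod A (S ∪ T)
    have h2 := submod B (A ∪ T)
    rw [show A ∩ (S ∪ T) = S by
        ext a
        have := @hSA a; have := @hTB a; have := @hXS a
        simp only [mem_inter_iff, mem_union, X] at this ⊢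
        tauto,
      show A ∪ (S ∪ T) = A ∪ T by rw [← union_assoc, union_eq_left.2 hSA]] at h1
    rw [show B ∩ (A ∪ T) = T by
        rw [inter_union_distrib_left, inter_eq_right.2 hTB, inter_comm, ← hX, union_eq_right.2 hXT],
      show B ∪ (A ∪ T) = N.E by
        rw [union_left_comm, union_eq_left.2 hTB, hAB]] at h2
    omega
  -- `split` only applies after X has been added to both traces of K; modularity on the B side pays
  -- for adding it.
  have lower : ∀ K, K ⊆ N.E → (N ↾ B).IsFlat (K ∩ B) →
      r (K ∩ A) + r (K ∩ B) ≤ r K + r (K ∩ X) := by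
    intro K hKE hK
    have h1 := submod K (K ∩ A ∪ X)
    have h2 := split (K ∩ A ∪ X) (K ∩ B ∪ X) subset_union_right
      (union_subset inter_subset_right inter_subset_left) subset_union_right
      (union_subset inter_subset_right inter_subset_right)
    have h3 := hmodB _ hK
    rw [show K ∩ (K ∩ A ∪ X) = K ∩ A by
      ext a; simp only [mem_inter_iff, mem_union, X]; tauto] at h1
    rw [show K ∩ A ∪ X ∪ (K ∩ B ∪ X) = K ∪ (K ∩ A ∪ X) by
      
      ext a; have := @hKE a; rw [← hAB] at this
      simp only [mem_inter_iff, mem_union] at this ⊢; tauto] at h2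
    rw [union_comm, show X ∩ (K ∩ B) = K ∩ X by
      ext a; simp only [mem_inter_iff, X]; tauto] at h3
    omega
  set G := N.closure F with hG
  have hFG : F ⊆ G := N.subset_closure F hF
  have hGE : G ⊆ N.E := N.closure_subset_ground F
  have hGfl : N.IsFlat G := N.isFlat_closure F
  have hGA := hGfl.inter_restrict hA
  have hGB := hGfl.inter_restrict hB
  have hGr : r G = r F := by
    have := N.eRk_closure_eq F
    rw [hrk, hrk] at this
    exact_mod_cast this
  have h1 := lower G hGE hGB
  have h2 := submod (F ∩ A) (F ∩ B)
  rw [show F ∩ A ∩ (F ∩ B) = F ∩ X by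
      ext a; simp only [mem_inter_iff, X]; tauto,
    show F ∩ A ∪ F ∩ B = F by rw [← inter_union_distrib_left, hAB]; exact inter_eq_left.2 hF] at h2
  have h3 := hmodB _ hFB
  -- Passing from F to G raises the rank on B at least as much as on X (`h3`, `h4`, `h5`). With
  -- `h1`, `h2` and r(G) = r(F), no increase is left for the A side.
  have h4 := submod (F ∩ B ∪ G ∩ X) X
  rw [show X ∩ (F ∩ B) = F ∩ X by
      ext a; simp only [mem_inter_iff, X]; tauto] at h3
  rw [show (F ∩ B ∪ G ∩ X) ∩ X = G ∩ X by
      ext a; have := @hFG a; simp only [mem_inter_iff, mem_union]; tauto,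
    show F ∩ B ∪ G ∩ X ∪ X = X ∪ F ∩ B by
      ext a; simp only [mem_inter_iff, mem_union, X]; tauto] at h4
  have h5 : r (F ∩ B ∪ G ∩ X) ≤ r (G ∩ B) := mono (by
    intro a; have := @hFG a; simp only [mem_inter_iff, mem_union, X]; tauto)
  have h6 : r (F ∩ A) ≤ r (G ∩ A) := mono (inter_subset_inter_left _ hFG)
  have eqOf : ∀ {C}, (N ↾ C).IsFlat (F ∩ C) → (N ↾ C).IsFlat (G ∩ C) → r (G ∩ C) ≤ r (F ∩ C) →
      F ∩ C = G ∩ C := by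
    intro C hFC hGC hle
    have : (N ↾ C).RankFinite := ((N.isRkFinite_set C)).rankFinite
    refine hFC.eq_of_subset_of_eRk_le hGC (inter_subset_inter_left _ hFG) ?_
    rw [restrict_eRk_eq _ inter_subset_right, restrict_eRk_eq _ inter_subset_right, hrk, hrk]
    exact_mod_cast hle
  have eA : F ∩ A = G ∩ A := eqOf hFA hGA (by omega)
  -- Agreement on A gives agreement on X, and then the same count leaves no increase on B either.
  have eX : F ∩ X = G ∩ X := by rw [hX, ← inter_assoc, ← inter_assoc, eA]
  rw [← eX] at h1
  have eB : F ∩ B = G ∩ B := eqOf hFB hGB (by rw [eA] at h2; omega)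
  have : F = G := by
    rw [← inter_eq_left.2 hF, ← inter_eq_left.2 hGE, ← hAB, inter_union_distrib_left,
      inter_union_distrib_left, eA, eB]
  rw [this]
  exact hGfl

/-- Restricting a generalized parallel connection to the ground set of one part gives that part. -/
theorem IsGenParallelConnection.restrict_left {P M₁ M₂ : Matroid α} {T : Set α}
    (hP : P.IsGenParallelConnection T M₁ M₂) : P ↾ M₁.E = M₁ := by
  have hT₁ : T ⊆ M₁.E := hP.inter_eq ▸ inter_subset_left
  have hT₂ : T ⊆ M₂.E := hP.inter_eq ▸ inter_subset_right
  have hE₁ : M₁.E ⊆ P.E := hP.ground_eq ▸ subset_union_left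
  have hflat : ∀ F, (P ↾ M₁.E).IsFlat F ↔ M₁.IsFlat F := by
    intro F
    by_cases hF : F ⊆ M₁.E
    swap
    · exact ⟨fun h => absurd h.subset_ground hF, fun h => absurd h.subset_ground hF⟩
    constructor
    · intro h
      rw [restrict_isFlat_iff hE₁ hF] at h
      rw [← h]
      exact ((hP.isFlat_iff _ (P.closure_subset_ground F)).1 (P.isFlat_closure F)).1
    · intro h
      have hFT := h.inter_restrict hT₁
      rw [hP.restrict_eq, restrict_isFlat_iff hT₂ inter_subset_right] at hFT
      -- A flat of `M₁` extends to a flat of P by closing its trace on T in `M₂`. Nothing new in T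
      -- is added, since the trace is already a flat of the common restriction to T.
      set K := M₂.closure (F ∩ T) with hK
      have hKE : K ⊆ M₂.E := M₂.closure_subset_ground _
      have hmem : ∀ a, a ∈ M₁.E → a ∈ M₂.E → a ∈ T := fun a h₁ h₂ => hP.inter_eq ▸ ⟨h₁, h₂⟩
      have hKT : ∀ a, a ∈ K → a ∈ T → a ∈ F := fun a h₁ h₂ =>
        (hFT.subset ⟨h₁, h₂⟩ : a ∈ F ∩ T).1
      have hFK : F ∩ T ⊆ K := M₂.subset_closure _ (inter_subset_right.trans hT₂)
      have e₁ : (F ∪ K) ∩ M₁.E = F := by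
        ext a; have := @hF a; have := @hKE a; have := hmem a; have := hKT a; grind
      have e₂ : (F ∪ K) ∩ M₂.E = K := by
        ext a; have := @hF a; have := @hKE a; have := hmem a; have := @hFK a; grind
      have hfl : P.IsFlat (F ∪ K) := by
        rw [hP.isFlat_iff, e₁, e₂]
        · exact ⟨h, M₂.isFlat_closure _⟩
        · rw [hP.ground_eq]
          exact union_subset_union hF hKE
      rw [← e₁]
      exact hfl.inter_restrict hE₁
  refine ext_closure fun S => ?_
  simp only [closure, hflat, restrict_ground_eq]

/-- An inequality form of `r*(E - L) = r*(E) - |L| + r(L)`. -/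
theorem dual_eRk_compl_add_encard_le {M : Matroid α} {L : Set α} (hL : L ⊆ M.E) :
    M✶.eRk (M.E \ L) + L.encard ≤ M✶.eRank + M.eRk L := by
  obtain ⟨I, hI⟩ := M✶.exists_isBasis (M.E \ L)
  obtain ⟨B, hB, hIB⟩ := hI.indep.exists_isBase_superset
  have hBI : B \ L ⊆ I := fun e he => by
    by_contra heI
    refine heI (hI.mem_of_insert_indep ⟨hB.subset_ground he.1, he.2⟩ ?_)
    exact hB.indep.subset (insert_subset he.1 hIB)
  -- E - B is a base of `M`, so L - B is independent in `M`; it accounts for the part of |L| not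
  -- counted in |B|.
  have hLB : (L \ B).encard ≤ M.eRk L := by
    refine Indep.encard_le_eRk_of_subset ?_ sdiff_subset
    exact (hB.compl_isBase_of_dual.indep).subset (sdiff_subset_sdiff_left hL)
  have hIe : I = B \ L := subset_antisymm (fun e he => ⟨hIB he, (hI.subset he).2⟩) hBI
  rw [← hI.encard_eq_eRk, ← hB.encard_eq_eRank, hIe, ← encard_sdiff_add_encard_inter L B,
    ← encard_sdiff_add_encard_inter B L, inter_comm L B, add_comm (L \ B).encard, ← add_assoc]
  gcongr

end Matroid

/-! ### Theta frames: dependence among the xᵢ and yᵢ. -/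

namespace Matroid

open Set

variable {α : Type*}

/-- The properties of `x₁, …, xₙ, y₁, …, yₙ` in `N` that make the restriction of `N` to these
elements a copy of `Θₙ`. -/
structure IsThetaFrame (N : Matroid α) {n : ℕ} (x y : Fin n → α) : Prop where
  three_le : 3 ≤ n
  injective : Function.Injective (Sum.elim x y)
  indep : N.Indep (range y)
  isCircuit : ∀ i, N.IsCircuit (insert (x i) (range y \ {y i}))
  eRk_le : N.eRk (range x) ≤ 2

namespace IsThetaFrame

variable {N : Matroid α} {n : ℕ} {x y : Fin n → α}

theorem x_injective (h : N.IsThetaFrame x y) : Function.Injective x :=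
  fun i j hij => Sum.inl_injective (h.injective (by simpa using hij))

theorem y_injective (h : N.IsThetaFrame x y) : Function.Injective y :=
  fun i j hij => Sum.inr_injective (h.injective (by simpa using hij))

theorem x_ne_y (h : N.IsThetaFrame x y) (i j : Fin n) : x i ≠ y j := by
  intro hij
  have := @h.injective (Sum.inl i) (Sum.inr j) (by simpa using hij)
  simp at this

theorem disjoint (h : N.IsThetaFrame x y) : Disjoint (range x) (range y) := by
  rw [Set.disjoint_left]
  rintro _ ⟨i, rfl⟩ ⟨j, hj⟩
  exact h.x_ne_y i j hj.symm

theorem x_mem_ground (h : N.IsThetaFrame x y) (i : Fin n) : x i ∈ N.E :=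
  (h.isCircuit i).subset_ground (mem_insert _ _)

theorem range_x_subset_ground (h : N.IsThetaFrame x y) : range x ⊆ N.E :=
  range_subset_iff.2 h.x_mem_ground

theorem restrict (h : N.IsThetaFrame x y) {R : Set α} (hx : range x ⊆ R)
    (hy : range y ⊆ R) : (N ↾ R).IsThetaFrame x y where
  three_le := h.three_le
  injective := h.injective
  indep := h.indep.indep_restrict_of_subset hy
  isCircuit i := (h.isCircuit i).isCircuit_restrict_of_subset
    (insert_subset (hx ⟨i, rfl⟩) (sdiff_subset.trans hy))
  eRk_le := by
    rw [restrict_eRk_eq _ hx]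
    exact h.eRk_le

theorem x_mem_closure (h : N.IsThetaFrame x y) (i : Fin n) :
    x i ∈ N.closure (range y \ {y i}) := by
  have := (h.isCircuit i).mem_closure_sdiff_singleton_of_mem (mem_insert (x i) _)
  rwa [insert_sdiff_self_of_notMem] at this
  rintro ⟨⟨j, hj⟩, -⟩
  exact h.x_ne_y i j hj.symm

/-- Both circuits are the fundamental circuit of xᵢ with respect to the independent set Y. -/
theorem eq_of_isCircuit_subset (h : N.IsThetaFrame x y) {i : Fin n} {C : Set α}
    (hC : N.IsCircuit C) (hCi : C ⊆ insert (x i) (range y)) :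
    C = insert (x i) (range y \ {y i}) := by
  rw [hC.eq_fundCircuit_of_subset h.indep hCi,
    (h.isCircuit i).eq_fundCircuit_of_subset h.indep (insert_subset_insert sdiff_subset)]

/-- The fundamental circuit of xᵢ uses yⱼ, so no circuit through xᵢ can avoid it. -/
theorem x_notMem_closure (h : N.IsThetaFrame x y) {i j : Fin n} (hij : i ≠ j) :
    x i ∉ N.closure (range y \ {y j}) := by
  intro hi
  obtain ⟨C, hCs, hC, -⟩ := exists_isCircuit_of_mem_closure hi
    (fun h' => by obtain ⟨k, hk⟩ := h'.1; exact h.x_ne_y i k hk.symm)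
  have hCeq := h.eq_of_isCircuit_subset hC (hCs.trans (insert_subset_insert sdiff_subset))
  have hmem : y j ∈ C := by
    rw [hCeq]
    exact mem_insert_of_mem _ ⟨⟨j, rfl⟩, fun h' => hij (h.y_injective h').symm⟩
  rcases hCs hmem with h' | h'
  · exact h.x_ne_y i j h'.symm
  · exact h'.2 rfl

/-- If xₛ were in the closure of xₜ, it would be spanned by Y - yₜ, which `x_notMem_closure`
forbids. -/
theorem indep_pair (h : N.IsThetaFrame x y) {s t : Fin n} (hst : s ≠ t) :
    N.Indep {x s, x t} := by
  have ht : N.Indep {x t} := by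
    refine (h.isCircuit t).ssubset_indep ⟨by simp, fun hsub => ?_⟩
    have := hsub (mem_insert_of_mem (x t) (⟨⟨s, rfl⟩, fun h' => hst (h.y_injective h')⟩ :
      y s ∈ range y \ {y t}))
    exact h.x_ne_y t s (by simpa using this.symm)
  rw [ht.insert_indep_iff]
  refine Or.inl ⟨h.x_mem_ground s, fun hs => h.x_notMem_closure hst ?_⟩
  have := N.closure_subset_closure_of_subset_closure
    (singleton_subset_iff.2 (h.x_mem_closure t))
  exact this hs

theorem range_x_subset_closure (h : N.IsThetaFrame x y) {s t : Fin n} (hst : s ≠ t) :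
    range x ⊆ N.closure {x s, x t} := by
  have hfin : N.IsRkFinite {x s, x t} := N.isRkFinite_of_finite (toFinite _)
  rw [hfin.closure_eq_closure_of_subset_of_eRk_ge_eRk (Y := range x)]
  · exact N.subset_closure _ h.range_x_subset_ground
  · rintro _ (rfl | rfl) <;> exact mem_range_self _
  · rw [(h.indep_pair hst).eRk_eq_encard, encard_pair (fun h' => hst (h.x_injective h'))]
    exact h.eRk_le

theorem eRk_range_x (h : N.IsThetaFrame x y) : N.eRk (range x) = 2 := by
  have hn := h.three_le
  have hst : (⟨0, by omega⟩ : Fin n) ≠ ⟨1, by omega⟩ := by simp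
  refine h.eRk_le.antisymm ?_
  rw [← encard_pair (fun h' => hst (h.x_injective h'))]
  refine (h.indep_pair hst).encard_le_eRk_of_subset ?_
  rintro _ (rfl | rfl) <;> exact mem_range_self _

theorem encard_range_y (h : N.IsThetaFrame x y) : (range y).encard = n := by
  rw [← image_univ, h.y_injective.encard_image]
  simp

theorem range_x_subset_closure_range_y (h : N.IsThetaFrame x y) :
    range x ⊆ N.closure (range y) := by
  rintro _ ⟨i, rfl⟩
  exact N.closure_subset_closure sdiff_subset (h.x_mem_closure i)

/-- The set has at most n elements, so it suffices that it spans Y. The pair xₛ, xₜ spans all of X,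
in particular x_u and x_v; the circuit of x_v then recovers y_u, and that of x_u recovers y_v. The
pairs {s, t} and {u, v} may overlap. -/
theorem indep_pair_union (h : N.IsThetaFrame x y) {s t u v : Fin n} (hst : s ≠ t) (huv : u ≠ v) :
    N.Indep ({x s, x t} ∪ y '' {u, v}ᶜ) := by
  set Z := {x s, x t} ∪ y '' {u, v}ᶜ with hZ
  have hZE : Z ⊆ N.E := by
    refine union_subset (h.indep_pair hst).subset_ground ?_
    exact (image_subset_range _ _).trans h.indep.subset_ground
  have hx : ∀ i, x i ∈ N.closure Z := fun i =>
    N.closure_subset_closure subset_union_left (h.range_x_subset_closure hst ⟨i, rfl⟩)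
  have hy : ∀ a b : Fin n, a ≠ b → ({a, b} : Set (Fin n)) = {u, v} → y a ∈ N.closure Z := by
    intro a b hab he
    have h1 := (h.isCircuit b).mem_closure_sdiff_singleton_of_mem (e := y a)
      (mem_insert_of_mem _ ⟨⟨a, rfl⟩, fun h' => hab (h.y_injective h')⟩)
    refine N.closure_subset_closure_of_subset_closure ?_ h1
    rintro e ⟨rfl | ⟨⟨j, rfl⟩, hjb⟩, hja⟩
    · exact hx b
    · refine N.mem_closure_of_mem (Or.inr ⟨j, ?_, rfl⟩) hZE
      rw [← he]
      rintro (rfl | rfl)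
      · exact hja rfl
      · exact hjb rfl
  have hspan : range y ⊆ N.closure Z := by
    rintro _ ⟨j, rfl⟩
    by_cases hju : j = u
    · subst hju
      exact hy j v huv rfl
    by_cases hjv : j = v
    · subst hjv
      exact hy j u huv.symm (pair_comm _ _)
    · exact N.mem_closure_of_mem (Or.inr ⟨j, by simp [hju, hjv], rfl⟩) hZE
  have hfin : Z.Finite := toFinite _
  have hcard : Z.encard ≤ n := by
    have h1 := encard_union_le {x s, x t} (y '' {u, v}ᶜ)
    have h2 : ({u, v} : Set (Fin n)).encard + ({u, v}ᶜ : Set (Fin n)).encard = n := by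
      rw [encard_add_encard_compl]
      simp
    rw [h.y_injective.encard_image, encard_pair (fun h' => hst (h.x_injective h')),
      ← encard_pair huv, h2] at h1
    exact h1
  rw [indep_iff_eRk_eq_encard_of_finite hfin]
  refine (N.eRk_le_encard Z).antisymm (hcard.trans ?_)
  rw [← h.encard_range_y, ← N.eRk_closure_eq Z]
  exact h.indep.encard_le_eRk_of_subset hspan

/-! ### Identification of a theta frame with Θₙ. -/

theorem indep_image_iff (h : N.IsThetaFrame x y) (I : Set (Fin n ⊕ Fin n)) :
    N.Indep (Sum.elim x y '' I) ↔ (theta n).Indep I := by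
  classical
  rw [theta_indep_iff]
  constructor
  · rintro hI C hC hCI
    have hI := hI.subset (image_mono hCI)
    rcases hC with ⟨i, j, k, hij, hik, hjk, rfl⟩ | ⟨i, rfl⟩ | ⟨s, t, u, hst, hsu, htu, rfl⟩
    · have h1 : (Sum.elim x y '' {Sum.inl i, Sum.inl j, Sum.inl k}).encard ≤ 2 := by
        refine (hI.encard_le_eRk_of_subset ?_).trans h.eRk_le
        rintro _ ⟨_, rfl | rfl | rfl, rfl⟩ <;> exact mem_range_self _
      rw [h.injective.encard_image, encard_insert_of_notMem (by simp [hij, hik]),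
        encard_pair (by simpa using hjk)] at h1
      norm_num at h1
    · refine (h.isCircuit i).not_indep (hI.subset ?_)
      rw [image_insert_eq, image_image]
      refine insert_subset_insert ?_
      rintro _ ⟨⟨j, rfl⟩, hj⟩
      exact ⟨j, fun h' => hj (by rw [mem_singleton_iff.1 h']; rfl), rfl⟩
    -- These are n + 1 elements in the closure of Y, which has rank n.
    · have h1 : (Sum.elim x y '' ({Sum.inl s, Sum.inl t} ∪ Sum.inr '' {u}ᶜ)).encard ≤ n := by
        rw [← h.encard_range_y, ← h.indep.eRk_eq_encard, ← N.eRk_closure_eq (range y)]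
        refine hI.encard_le_eRk_of_subset ?_
        rintro _ ⟨_, (rfl | rfl) | ⟨j, -, rfl⟩, rfl⟩
        · exact h.range_x_subset_closure_range_y ⟨s, rfl⟩
        · exact h.range_x_subset_closure_range_y ⟨t, rfl⟩
        · exact N.mem_closure_of_mem (mem_range_self j) h.indep.subset_ground
      have h2 : ({u} : Set (Fin n)).encard + ({u}ᶜ : Set (Fin n)).encard = n := by
        rw [encard_add_encard_compl]
        simp
      rw [h.injective.encard_image, encard_union_eq (by
          rw [Set.disjoint_left]
          rintro _ (rfl | rfl) <;> simp),
        encard_pair (by simpa using hst), Sum.inr_injective.encard_image, ← h2,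
        encard_singleton] at h1
      have hfin : ({u}ᶜ : Set (Fin n)).encard ≠ ⊤ := (toFinite _).encard_lt_top.ne
      have := (ENat.add_le_add_iff_right hfin).1 h1
      norm_num at this
  · intro hI
    obtain ⟨h1, h2, h3⟩ := (thetaP_iff I).1 hI
    set A := Finset.univ.filter fun i => Sum.inl i ∈ I with hA
    set B := Finset.univ.filter fun i => Sum.inr i ∈ I with hB
    have hIAB : Sum.elim x y '' I = x '' A ∪ y '' B := by
      ext e
      simp [hA, hB]
    rw [hIAB]
    by_cases hA0 : A.card = 0
    · rw [Finset.card_eq_zero.1 hA0]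
      simpa using h.indep.subset (image_subset_range y B)
    by_cases hA1 : A.card = 1
    · obtain ⟨i, hi⟩ := Finset.card_eq_one.1 hA1
      rw [hi, Finset.coe_singleton, image_singleton, singleton_union]
      by_contra hdep
      have hsub : insert (x i) (y '' B) ⊆ insert (x i) (range y) :=
        insert_subset_insert (image_subset_range y B)
      have hE : insert (x i) (y '' B) ⊆ N.E :=
        hsub.trans (insert_subset (h.x_mem_ground i) h.indep.subset_ground)
      obtain ⟨C, hCs, hC⟩ := (show N.Dep _ from ⟨hdep, hE⟩).exists_isCircuit_subset
      rw [h.eq_of_isCircuit_subset hC (hCs.trans hsub)] at hCs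
      refine h3 i ⟨hi, (Finset.eq_of_subset_of_card_le (fun j hj => ?_) ?_).symm⟩
      · rw [Finset.mem_compl, Finset.mem_singleton] at hj
        rcases hCs (mem_insert_of_mem _ ⟨⟨j, rfl⟩, fun h' => hj (h.y_injective h')⟩) with
          h' | ⟨k, hk, h'⟩
        · exact absurd h'.symm (h.x_ne_y i j)
        · rwa [← h.y_injective h']
      · have := theta_card_compl i
        omega
    · obtain ⟨s, t, hst, hAst⟩ := Finset.card_eq_two.1 (show A.card = 2 by omega)
      -- With two x's present, the bound |A| + |B| ≤ n leaves at least two y's out, as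
      -- `indep_pair_union` requires.
      have hBc : 1 < Bᶜ.card := by
        have := Finset.card_add_card_compl B
        rw [Fintype.card_fin] at this
        omega
      obtain ⟨u, v, hu, hv, huv⟩ := Finset.one_lt_card_iff.1 hBc
      refine (h.indep_pair_union hst huv).subset (union_subset_union ?_ (image_mono ?_))
      · rw [hAst]
        simp [image_insert_eq]
      · intro b hb
        rw [Finset.mem_compl] at hu hv
        rintro (rfl | rfl)
        · exact hu hb
        · exact hv hb

/-- The restriction to the elements of a theta frame is `Θₙ`. -/
theorem restrict_eq_thetaOn (h : N.IsThetaFrame x y) (hxy : Function.Injective (Sum.elim x y)) :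
    N ↾ (range x ∪ range y) = thetaOn x y hxy := by
  refine ext_indep ?_ fun I hI => ?_
  · simp [thetaOn, theta]
  · rw [restrict_ground_eq] at hI
    rw [← Sum.elim_range] at hI ⊢
    obtain ⟨J, rfl⟩ := subset_range_iff_exists_image_eq.1 hI
    rw [restrict_indep_iff, and_iff_left hI, h.indep_image_iff, thetaOn, map_indep_iff]
    exact ⟨fun hJ => ⟨J, hJ, rfl⟩, fun ⟨K, hK, hJK⟩ => by
      rwa [h.injective.image_injective hJK]⟩

/-! ### Modularity of X in Θₙ. -/

/-- Since n ≥ 3, two labels u, v other than j can be dropped, so some independent set contains yⱼ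
and a pair of x's spanning X. Hence X does not span yⱼ. -/
theorem isFlat_range_x (h : N.IsThetaFrame x y) (hE : N.E = range x ∪ range y) :
    N.IsFlat (range x) := by
  have hn := h.three_le
  rw [isFlat_iff_closure_eq]
  refine subset_antisymm (fun e he => ?_) (N.subset_closure _ h.range_x_subset_ground)
  have heE := N.closure_subset_ground _ he
  rw [hE] at heE
  refine heE.resolve_right ?_
  rintro ⟨j, rfl⟩
  have hst : (⟨0, by omega⟩ : Fin n) ≠ ⟨1, by omega⟩ := by simp
  have hc : 1 < ({j}ᶜ : Finset (Fin n)).card := by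
    have := theta_card_compl j
    omega
  obtain ⟨u, v, hu, hv, huv⟩ := Finset.one_lt_card_iff.1 hc
  simp only [Finset.mem_compl, Finset.mem_singleton] at hu hv
  have hind := (h.indep_pair_union hst huv).notMem_closure_sdiff_of_mem
    (e := y j) (Or.inr ⟨j, by simp [Ne.symm hu, Ne.symm hv], rfl⟩)
  refine hind (N.closure_subset_closure_of_subset_closure (Y := _) (X := range x) ?_ he)
  refine (h.range_x_subset_closure hst).trans (N.closure_subset_closure ?_)
  rintro e he'
  refine ⟨Or.inl he', ?_⟩
  rintro rfl
  rcases he' with h' | h'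
  · exact h.x_ne_y _ _ h'.symm
  · exact h.x_ne_y _ _ h'.symm

/-- A flat G contains X, meets X in one point, or misses X. In the second case one further xₜ spans
the rest of X over G; in the third, G is a subset of Y and skew to X. -/
theorem isModularFlat_range_x (h : N.IsThetaFrame x y) (hE : N.E = range x ∪ range y) :
    N.IsModularFlat (range x) := by
  have hn := h.three_le
  refine ⟨h.isFlat_range_x hE, fun G hG => ?_⟩
  by_cases hXG : range x ⊆ G
  · rw [union_eq_right.2 hXG, inter_eq_left.2 hXG, add_comm]
  obtain ⟨_, ⟨t, rfl⟩, htG⟩ := not_subset.1 hXG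
  have htcl : x t ∈ N.E \ N.closure G := ⟨h.x_mem_ground t, by rwa [hG.closure]⟩
  by_cases hs : ∃ s, x s ∈ G
  · obtain ⟨s, hs⟩ := hs
    have hst : s ≠ t := by rintro rfl; exact htG hs
    have hint : range x ∩ G = {x s} := by
      refine subset_antisymm ?_ (singleton_subset_iff.2 ⟨⟨s, rfl⟩, hs⟩)
      rintro _ ⟨⟨k, rfl⟩, hk⟩
      by_contra hks
      have hks : k ≠ s := by rintro rfl; exact hks rfl
      refine hXG ((h.range_x_subset_closure hks).trans ?_)
      rw [← hG.closure]
      exact N.closure_subset_closure (pair_subset hk hs)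
    have hun : N.eRk (range x ∪ G) = N.eRk G + 1 := by
      rw [← eRk_insert_eq_add_one htcl]
      refine le_antisymm ?_ (N.eRk_mono (insert_subset (Or.inl ⟨t, rfl⟩) subset_union_right))
      rw [← N.eRk_closure_eq (insert _ _)]
      refine N.eRk_mono (union_subset ?_ ?_)
      · refine (h.range_x_subset_closure hst).trans (N.closure_subset_closure ?_)
        exact pair_subset (mem_insert_of_mem _ hs) (mem_insert _ _)
      · exact N.subset_closure_of_subset' (subset_insert _ _) hG.subset_ground
    have hone : N.eRk {x s} = 1 := by
      rw [((h.indep_pair hst).subset (by simp)).eRk_eq_encard, encard_singleton]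
    rw [hint, hun, hone, h.eRk_range_x, add_assoc, one_add_one_eq_two, add_comm]
  · push Not at hs
    have hint : range x ∩ G = ∅ := by
      rw [eq_empty_iff_forall_notMem]
      rintro _ ⟨⟨k, rfl⟩, hk⟩
      exact hs k hk
    have hGy : G ⊆ range y := fun e he => by
      have := hG.subset_ground he
      rw [hE] at this
      refine this.resolve_left ?_
      rintro ⟨k, rfl⟩
      exact hs k he
    -- Otherwise G contains Y - yᵢ and hence xᵢ. Applying this twice gives two distinct y's outside
    -- G.
    have hmiss : ∀ i, ∃ j, j ≠ i ∧ y j ∉ G := by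
      intro i
      by_contra! hcon
      refine hs i ?_
      rw [← hG.closure]
      refine N.closure_subset_closure ?_ (h.x_mem_closure i)
      rintro _ ⟨⟨j, rfl⟩, hj⟩
      exact hcon j (by rintro rfl; exact hj rfl)
    obtain ⟨u, -, hu⟩ := hmiss t
    obtain ⟨v, hvu, hv⟩ := hmiss u
    obtain ⟨s, hst⟩ : ∃ s, s ≠ t := by
      obtain ⟨j, hj, -⟩ := hmiss t
      exact ⟨j, hj⟩
    have hind : N.Indep ({x s, x t} ∪ G) := by
      refine (h.indep_pair_union hst hvu.symm).subset (union_subset_union_right _ ?_)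
      intro e he
      obtain ⟨j, rfl⟩ := hGy he
      refine ⟨j, ?_, rfl⟩
      rintro (rfl | rfl)
      · exact hu he
      · exact hv he
    have hun : N.eRk (range x ∪ G) = N.eRk ({x s, x t} ∪ G) := by
      rw [← N.eRk_union_closure_left_eq {x s, x t}]
      refine le_antisymm (N.eRk_mono (union_subset_union_left _ (h.range_x_subset_closure hst))) ?_
      rw [N.eRk_union_closure_left_eq]
      refine N.eRk_mono (union_subset_union_left _ (pair_subset ⟨s, rfl⟩ ⟨t, rfl⟩))
    have hdisj : Disjoint {x s, x t} G := by
      rw [Set.disjoint_left]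
      rintro _ (rfl | rfl) <;> exact hs _
    rw [hint, hun, hind.eRk_eq_encard, encard_union_eq hdisj, h.eRk_range_x, eRk_empty, add_zero,
      encard_pair (fun h' => hst (h.x_injective h')), (hind.subset subset_union_right).eRk_eq_encard]

end IsThetaFrame

end Matroid

/-! ### Caramboles, and the decomposition of the dual. -/

namespace Matroid

open Set

variable {α : Type*} {n : ℕ}

/-- In a 3-connected matroid, a set of rank two with at least two elements inside and outside
is coindependent. -/
theorem IsThreeConnected.coindep {M : Matroid α} [M.Finite] (hM : M.IsThreeConnected) {L : Set α}
    (hLE : L ⊆ M.E) (hL : M.eRk L = 2) (hLc : 2 ≤ (M.E \ L).encard) : M✶.Indep L := by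
  rw [← coindep_def, coindep_iff_compl_spanning, spanning_iff_eRk_le]
  -- A nonspanning complement would make L a 2-separation.
  by_contra! hlt
  refine hM 2 (by norm_num) (by norm_num) L ⟨hLE, hL.symm.trans_le (M.eRk_le_encard L), hLc, ?_⟩
  rw [hL, add_comm]
  exact (ENat.add_lt_add_iff_right (by simp)).2 hlt

/-- The elements of a carambole are a theta frame of the dual matroid. -/
theorem IsCarambole.isThetaFrame {M : Matroid α} [M.Finite] {x y : Fin n → α}
    (hK : M.IsCarambole x y) (hM : M.IsThreeConnected) (hdisj : Disjoint (range y) (range x))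
    (hx : 2 ≤ (range x).encard) : M✶.IsThetaFrame x y := by
  have hLE : range y ⊆ M.E := hK.contractible.1
  have hxE : range x ⊆ M.E := by
    rintro _ ⟨i, rfl⟩
    exact (hK.isCocircuit i).subset_ground (mem_insert _ _)
  have hind : M✶.Indep (range y) := hM.coindep hLE hK.isLine.2
    (hx.trans (encard_mono (subset_sdiff.2 ⟨hxE, hdisj.symm⟩)))
  have hne : ∀ i j, x i ≠ y j := fun i j h => Set.disjoint_left.1 hdisj ⟨j, rfl⟩ ⟨i, h⟩
  have hinj : Function.Injective x := by
    intro i j hij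
    by_contra hne'
    have hCne : insert (x i) (range y \ {y i}) ≠ insert (x j) (range y \ {y j}) := by
      intro h
      have hmem : y j ∈ insert (x i) (range y \ {y i}) :=
        mem_insert_of_mem _ ⟨⟨j, rfl⟩, fun h' => hne' (hK.injective h').symm⟩
      rw [h] at hmem
      rcases hmem with h' | h'
      · exact hne j j h'.symm
      · exact h'.2 rfl
    -- If xᵢ = xⱼ, eliminating it from two different cocircuits leaves a cocircuit inside Y, which
    -- is independent in the dual.
    obtain ⟨C, hCs, hC⟩ :=
      (hK.isCocircuit i).isCircuit.elimination (hK.isCocircuit j).isCircuit hCne (x i)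
    refine hC.not_indep (hind.subset fun e he => ?_)
    rcases hCs he with ⟨(rfl | h') | (rfl | h'), hei⟩
    · exact absurd rfl hei
    · exact h'.1
    · exact absurd hij.symm hei
    · exact h'.1
  have hcl : range x ⊆ M✶.closure (range y) := by
    rintro _ ⟨i, rfl⟩
    have := (hK.isCocircuit i).isCircuit.mem_closure_sdiff_singleton_of_mem (mem_insert (x i) _)
    refine M✶.closure_subset_closure ?_ this
    rintro e ⟨rfl | h', hei⟩
    · exact absurd rfl hei
    · exact h'.1
  refine ⟨hK.three_le, hinj.sumElim hK.injective hne, hind, hK.isCocircuit, ?_⟩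
  -- X lies in both cl*(Y) and E - Y, so r*(X) + r*(E) ≤ |Y| + r*(E - Y) ≤ r*(E) + 2.
  have h1 := dual_eRk_compl_add_encard_le hLE
  have h2 := M✶.eRk_inter_add_eRk_union_le (M✶.closure (range y)) (M.E \ range y)
  have h3 : M✶.eRk (M✶.closure (range y) ∪ M.E \ range y) = M✶.eRank := by
    refine eRk_eq_eRank fun e he => ?_
    by_cases hey : e ∈ range y
    · exact Or.inl (M✶.mem_closure_of_mem hey hLE)
    · exact Or.inr ⟨he, hey⟩
  have h4 : range x ⊆ M✶.closure (range y) ∩ (M.E \ range y) :=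
    subset_inter hcl (subset_sdiff.2 ⟨hxE, hdisj.symm⟩)
  rw [h3, eRk_closure_eq, hind.eRk_eq_encard, add_comm (range y).encard] at h2
  rw [hK.isLine.2, add_comm M✶.eRank] at h1
  exact (M✶.eRk_mono h4).trans
    ((ENat.add_le_add_iff_right (M✶.eRank_ne_top_iff.2 inferInstance)).1 (h2.trans h1))

/-- A matroid with a theta frame `x, y` satisfying `r(E - Y) + |Y| ≤ r(E) + 2` is the generalized
parallel connection of `Θₙ` and the matroid obtained by deleting `Y`. -/
theorem IsThetaFrame.isGenParallelConnection {N : Matroid α} [N.RankFinite] {x y : Fin n → α}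
    (h : N.IsThetaFrame x y) (hxy : Function.Injective (Sum.elim x y))
    (hr : N.eRk (N.E \ range y) + (range y).encard ≤ N.eRank + 2) :
    N.IsGenParallelConnection (range x) (N ＼ range y) (thetaOn x y hxy) := by
  have hxE := h.range_x_subset_ground
  have hyE := h.indep.subset_ground
  have hRE : range x ∪ range y ⊆ N.E := union_subset hxE hyE
  have hxA : range x ⊆ N.E \ range y := subset_sdiff.2 ⟨hxE, h.disjoint⟩
  have hinter : (N.E \ range y) ∩ (range x ∪ range y) = range x := by
    rw [inter_union_distrib_left, inter_eq_right.2 hxA, sdiff_inter_self, union_empty]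
  have hunion : (N.E \ range y) ∪ (range x ∪ range y) = N.E := by
    rw [union_left_comm, sdiff_union_of_subset hyE, union_eq_right.2 hxE]
  have hmod : (N ↾ (range x ∪ range y)).IsModularFlat (range x) :=
    (h.restrict subset_union_left subset_union_right).isModularFlat_range_x rfl
  have hR : N.eRk (range x ∪ range y) = (range y).encard := by
    rw [← h.indep.eRk_eq_encard]
    refine le_antisymm ?_ (N.eRk_mono subset_union_right)
    rw [← N.eRk_closure_eq (range y)]
    exact N.eRk_mono (union_subset h.range_x_subset_closure_range_y (N.subset_closure _ hyE))
  rw [← h.restrict_eq_thetaOn hxy, delete_eq_restrict]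
  refine ⟨hinter, ?_, Or.inr ?_, hunion.symm, fun F hF => ?_⟩
  · rw [restrict_restrict_eq _ hxA, restrict_restrict_eq _ subset_union_left]
  · rw [IsModularlyEmbedded, hmod.1.closure]
    exact ⟨hmod, fun e he => absurd he.1 he.2⟩
  · refine ⟨fun hfl => ⟨hfl.inter_restrict sdiff_subset, hfl.inter_restrict hRE⟩, fun hfl => ?_⟩
    -- As r(X ∪ Y) = |Y| and r(X) = 2, the hypothesis `hr` is exactly the tightness needed for
    -- gluing.
    refine isFlat_of_isModularFlat_restrict hunion ?_ (hinter.symm ▸ hmod) hF hfl.1 hfl.2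
    rwa [hinter, hR, h.eRk_range_x]

end Matroid

theorem mainTheorem8 {α : Type*} {n : ℕ} (x y : Fin n → α) (M H : Matroid α)
    [M.Finite] [H.Finite]
    (hH : H.IsCosimple)
    (hXH : Set.range x ⊆ H.E)
    (hXr : H✶.eRk (Set.range x) = 2)
    (hLH : Disjoint (Set.range y) H.E)
    (hM : M.IsThreeConnected)
    (hMs : M.IsSimple)
    (hK : M.IsCarambole x y) :
    ∃ hxy : Function.Injective (Sum.elim x y),
      (H = M.contract (Set.range y) ↔
        M✶.IsGenParallelConnection (Set.range x) H✶ (Matroid.thetaOn x y hxy)) := by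
  -- X lies in E(H), hence is disjoint from Y; having rank two in `H✶`, it has at least two
  -- elements.
  have hframe : M✶.IsThetaFrame x y := hK.isThetaFrame hM (hLH.mono_right hXH)
    (hXr.symm.trans_le (H✶.eRk_le_encard _))
  refine ⟨hframe.injective, ?_, fun hP => ?_⟩
  · rintro rfl
    rw [Matroid.dual_contract]
    refine hframe.isGenParallelConnection _ ?_
    have := Matroid.dual_eRk_compl_add_encard_le hK.contractible.1
    rwa [hK.isLine.2] at this
  · have hE : H.E = M.E \ Set.range y := by
      have hground : M.E = H.E ∪ (Set.range x ∪ Set.range y) := by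
        have := hP.ground_eq
        rw [← hframe.restrict_eq_thetaOn hframe.injective] at this
        exact this
      rw [hground, ← Set.union_assoc, Set.union_eq_left.2 hXH, Set.union_sdiff_right,
        hLH.symm.sdiff_eq_left]
    -- Restricting to E(H) = E(M) - Y is deleting Y from `M✶`, which is dual to contracting Y in
    -- `M`.
    have hres := hP.restrict_left
    rw [Matroid.dual_ground, hE] at hres
    rw [← Matroid.dual_inj, Matroid.dual_contract, Matroid.delete_eq_restrict, Matroid.dual_ground,
      hres]
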